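/- Consider the system $x_{t+1}=Ax_t+Bu_t+w_t$, $y_t=Cx_t+v_t$ ($t=0,1,\dots$), where $x_t,w_t\in\mathbb R^{n_x}$, $u_t\in\mathbb R^{n_u}$, $y_t\in\mathbb R^{n_y}$, the initial state $x_0$ has a given law with finite second moment, and $v_t\sim N(0,M)$. Let $I_t=(y_0,\dots,y_t,u_0,\dots,u_{t-1})$. A control policy $\pi=(\pi_t)_{t\ge0}\in\Pi$ consists of measurable maps with $u_t=\pi_t(I_t)$; a distribution policy $\gamma=(\gamma_t)_{t\ge0}\in\Gamma$ consists of measurable maps $\gamma_t$ from information vectors to Borel probability measures on $\mathbb R^{n_x}$: conditionally on the past, $w_t$ has law $\mathbb P_t=\gamma_t(I_t)$. The variables $x_0$, $v_0$ are independent, and, given the past up to time $t$, $v_{t+1}$ is independent of $w_t$ and still has law $N(0,M)$. Let $Q\succeq0$, $R\succ0$, $\lambda>0$, and let $\mathbb Q_t$ be nominal probability measures on $\mathbb R^{n_x}$ with finite second moments. Let $W_2$ be the Wasserstein distance of order $2$ for the Euclidean norm, and let $\mathrm G$ be the Gelbrich distance, $$\mathrm G(\mathbb P,\mathbb P')^2=\|m-m'\|^2+\mathrm{Tr}\big[\Sigma+\Sigma'-2(\Sigma'^{1/2}\Sigma\Sigma'^{1/2})^{1/2}\big],$$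 where $m,m'$ and $\Sigma,\Sigma'$ are the means and covariance matrices of $\mathbb P,\mathbb P'$ (and $\mathrm G=\infty$ if one of the two measures has infinite second moment). For $D\in\{\mathrm G,W_2\}$ put $$J_D(\pi,\gamma)=\limsup_{T\to\infty}\frac1T\,\mathbb E\Big[\sum_{t=0}^{T-1}\Big(\mathbb E[x_t^\top Qx_t+u_t^\top Ru_t\mid I_t,u_t]-\lambda D(\mathbb P_t,\mathbb Q_t)^2\Big)\Big]\in[-\infty,\infty],$$ which is defined if for no $T$ both the expected running cost and the expected penalty over the stages $0,\dots,T-1$ are infinite. A pair $(\pi^*,\gamma^*)\in\Pi\times\Gamma$ is called optimal for $\min_{\pi\in\Pi}\max_{\gamma\in\Gamma}J_D(\pi,\gamma)$ if $J_D(\pi^*,\gamma^*)$ is defined and $$J_D(\pi^*,\gamma)\le J_D(\pi^*,\gamma^*)\le J_D(\pi,\gamma^*)$$ for all $\pi\in\Pi$ and $\gamma\in\Gamma$ for which the respective outer cost is defined. A probability measure on $\mathbb R^{n}$ is called elliptical with density generating function $g:[0,\infty)\to[0,\infty)$ ($g$ measurable, $0<\int_{\mathbb R^n} g(\|z\|^2)\,dz<\infty$)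 if it is the law of $m+S^{1/2}Z$ for some $m\in\mathbb R^{n}$ and some positive semidefinite matrix $S$, where $Z$ has density proportional to $g(\|z\|^2)$. (If $S\succ0$, this means that it has density $c\det(S)^{-1/2}g((w-m)^\top S^{-1}(w-m))$.) Suppose that for every $t$ the nominal distribution $\mathbb Q_t$ is elliptical with density generating function $g_t$. Let $(\pi^*,\gamma^*)$ be an optimal pair for the Gelbrich-penalized problem $\min_{\pi\in\Pi}\max_{\gamma\in\Gamma}J_{\mathrm G}(\pi,\gamma)$ such that, for every $t$ and every $I_t$, the distribution $\gamma_t^*(I_t)$ is elliptical with the same density generating function $g_t$. Then $(\pi^*,\gamma^*)$ is an optimal pair for the Wasserstein-penalized problem $\min_{\pi\in\Pi}\max_{\gamma\in\Gamma}J_{W_2}(\pi,\gamma)$. -/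

import Mathlib

open MeasureTheory ProbabilityTheory Filter
open scoped ENNReal NNReal Matrix MatrixOrder

namespace WDRC

noncomputable section

/-- Euclidean space of dimension `n`, with the Euclidean norm and its Borel sets. -/
abbrev E (n : ℕ) : Type := EuclideanSpace ℝ (Fin n)

/-- The action of a matrix on a Euclidean vector. -/
def act {m n : ℕ} (L : Matrix (Fin m) (Fin n) ℝ) (z : E n) : E m :=
  WithLp.toLp 2 (L *ᵥ z.ofLp)

/-- The quadratic form `zᵀ L z`. -/
def quad {n : ℕ} (L : Matrix (Fin n) (Fin n) ℝ) (z : E n) : ℝ :=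
  z.ofLp ⬝ᵥ (L *ᵥ z.ofLp)

@[fun_prop]
theorem measurable_act {m n : ℕ} (L : Matrix (Fin m) (Fin n) ℝ) : Measurable (act L) := by
  have h : Continuous (act L) := by
    unfold act
    fun_prop
  exact h.measurable

/-! ### Wasserstein distance, Gelbrich distance, elliptical distributions -/

/-- Transport plans with marginals `P` and `Q`. -/
def couplings {n : ℕ} (P Q : Measure (E n)) : Set (Measure (E n × E n)) :=
  {τ | τ.map Prod.fst = P ∧ τ.map Prod.snd = Q}

/-- The Wasserstein distance of order 2, with values in `[0, ∞]`. -/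
def wasserstein2 {n : ℕ} (P Q : Measure (E n)) : ℝ≥0∞ :=
  ⨅ τ ∈ couplings P Q, (∫⁻ z, ‖z.1 - z.2‖ₑ ^ 2 ∂τ) ^ (1 / 2 : ℝ)

/-- The mean vector of `P`. -/
def meanVec {n : ℕ} (P : Measure (E n)) : E n := ∫ w, w ∂P

/-- The covariance matrix of `P`. -/
def covMat {n : ℕ} (P : Measure (E n)) : Matrix (Fin n) (Fin n) ℝ :=
  Matrix.of fun i j => ∫ w, (w i - meanVec P i) * (w j - meanVec P j) ∂P

/-- `B²(S, S') = Tr[S + S' - 2 (S'^{1/2} S S'^{1/2})^{1/2}]`. -/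
def buresSq {n : ℕ} (S S' : Matrix (Fin n) (Fin n) ℝ) : ℝ :=
  (S + S' - (2 : ℝ) • CFC.sqrt (CFC.sqrt S' * S * CFC.sqrt S')).trace

/-- `P` has finite first and second moments. -/
def FiniteSecondMoment {n : ℕ} (P : Measure (E n)) : Prop := MemLp (fun w : E n => w) 2 P

open scoped Classical in
/-- The Gelbrich distance, a function of means and covariances. Where these do not exist, i.e. if one
of the two distributions has an infinite second moment, its value is `∞`. -/
def gelbrich {n : ℕ} (P Q : Measure (E n)) : ℝ≥0∞ :=
  if FiniteSecondMoment P ∧ FiniteSecondMoment Q then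
    ENNReal.ofReal (√(‖meanVec P - meanVec Q‖ ^ 2 + buresSq (covMat P) (covMat Q)))
  else ∞

/-- The unnormalized rotation invariant measure with Lebesgue density `z ↦ g (‖z‖²)`. -/
def sphericalMeasure (n : ℕ) (g : ℝ≥0 → ℝ≥0) : Measure (E n) :=
  volume.withDensity fun z => (g (‖z‖₊ ^ 2) : ℝ≥0∞)

/-- `P` is elliptical with density generating function `g`: it is the law of `m + L Z`, where `m` is
a vector, `L` a symmetric positive semidefinite matrix, and `Z` has density proportional to
`g (‖z‖²)`. If `L` is invertible, this says that `P` has density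
`c det(S)^{-1/2} g((w - m)ᵀ S⁻¹ (w - m))` with `S = L²`; singular dispersion matrices `S`
are allowed. -/
def IsElliptical {n : ℕ} (g : ℝ≥0 → ℝ≥0) (P : Measure (E n)) : Prop :=
  Measurable g ∧ sphericalMeasure n g Set.univ ≠ 0 ∧ sphericalMeasure n g Set.univ ≠ ∞ ∧
    ∃ (m : E n) (L : Matrix (Fin n) (Fin n) ℝ), L.PosSemidef ∧
      P = ((sphericalMeasure n g Set.univ)⁻¹ • sphericalMeasure n g).map fun z => m + act L z

/-! ### The partially observable linear system and the policies -/

/-- Data of the system `x_{t+1} = A x_t + B u_t + w_t`, `y_t = C x_t + v_t` with `v_t ∼ N(0, M)`,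
the law of `x_0` (with finite second moment) and the quadratic cost weights `Q`, `R`. -/
structure LinearSystem (nx nu ny : ℕ) where
  A : Matrix (Fin nx) (Fin nx) ℝ
  B : Matrix (Fin nx) (Fin nu) ℝ
  C : Matrix (Fin ny) (Fin nx) ℝ
  M : Matrix (Fin ny) (Fin ny) ℝ
  Q : Matrix (Fin nx) (Fin nx) ℝ
  R : Matrix (Fin nu) (Fin nu) ℝ
  initLaw : Measure (E nx)
  M_posSemidef : M.PosSemidef
  Q_posSemidef : Q.PosSemidef
  R_posDef : R.PosDef
  initLaw_prob : IsProbabilityMeasure initLaw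
  initLaw_moment : FiniteSecondMoment initLaw

/-- The space of information vectors `I_t = (y_0, …, y_t, u_0, …, u_{t-1})`. -/
abbrev Info (nu ny t : ℕ) : Type := (Fin (t + 1) → E ny) × (Fin t → E nu)

/-- The update `I_{t+1} = (I_t, y_{t+1}, u_t)` of the information vector. -/
def updateInfo {nu ny t : ℕ} (I : Info nu ny t) (y : E ny) (u : E nu) : Info nu ny (t + 1) :=
  (Fin.snoc (α := fun _ => E ny) I.1 y, Fin.snoc (α := fun _ => E nu) I.2 u)

/-- Admissible control policies: measurable maps `I_t ↦ u_t` for every `t`. -/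
structure ControlPolicy (nu ny : ℕ) where
  toFun : ∀ t, Info nu ny t → E nu
  measurable : ∀ t, Measurable (toFun t)

/-- Admissible distribution policies: measurable maps `I_t ↦ P_t`, with `P_t` an arbitrary Borel
probability measure, for every `t`; that is, Markov kernels. -/
structure DistPolicy (nx nu ny : ℕ) where
  toKernel : ∀ t, Kernel (Info nu ny t) (E nx)
  markov : ∀ t, IsMarkovKernel (toKernel t)

/-- The variables `(x_t, y_t, u_t)` of one stage. -/
abbrev Stage (nx nu ny : ℕ) : Type := E nx × E ny × E nu

/-- The variables of the stages `0, …, t`. -/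
abbrev Hist (nx nu ny t : ℕ) : Type := (_i : Finset.Iic t) → Stage nx nu ny

/-- The information vector `I_t` as a function of the variables of the stages `0, …, t`. -/
def infoOfHist {nx nu ny : ℕ} (t : ℕ) (h : Hist nx nu ny t) : Info nu ny t :=
  (fun k => (h ⟨k, Finset.mem_Iic.2 (Nat.lt_succ_iff.1 k.2)⟩).2.1,
   fun k => (h ⟨k, Finset.mem_Iic.2 k.2.le⟩).2.2)

@[fun_prop]
theorem measurable_updateInfo {nu ny t : ℕ} :
    Measurable fun p : Info nu ny t × E ny × E nu => updateInfo p.1 p.2.1 p.2.2 := by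
  refine Measurable.prodMk ?_ ?_
  · refine measurable_pi_iff.2 fun i => ?_
    refine Fin.lastCases ?_ (fun j => ?_) i
    · simp only [Fin.snoc_last]; fun_prop
    · simp only [Fin.snoc_castSucc]; fun_prop
  · refine measurable_pi_iff.2 fun i => ?_
    refine Fin.lastCases ?_ (fun j => ?_) i
    · simp only [Fin.snoc_last]; fun_prop
    · simp only [Fin.snoc_castSucc]; fun_prop

@[fun_prop]
theorem measurable_infoOfHist {nx nu ny : ℕ} (t : ℕ) :
    Measurable (infoOfHist (nx := nx) (nu := nu) (ny := ny) t) := by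
  unfold infoOfHist
  fun_prop

namespace LinearSystem

variable {nx nu ny : ℕ}

/-- The law `N(0, M)` of the output noise. -/
def noise (S : LinearSystem nx nu ny) : Measure (E ny) := multivariateGaussian 0 S.M

instance (S : LinearSystem nx nu ny) : IsProbabilityMeasure S.noise := by
  unfold noise
  infer_instance

/-- The first stage: `(x_0, v_0) ↦ (x_0, y_0, u_0)` with `y_0 = C x_0 + v_0` and `u_0 = π_0(I_0)`,
where `I_0 = y_0`. -/
def firstStage (S : LinearSystem nx nu ny) (pi : ControlPolicy nu ny) (p : E nx × E ny) :
    Stage nx nu ny :=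
  let y := act S.C p.1 + p.2
  (p.1, y, pi.toFun 0 (fun _ => y, Fin.elim0))

/-- The next stage, from the history up to time `t` and the noises `(w_t, v_{t+1})`:
`x_{t+1} = A x_t + B u_t + w_t`, `y_{t+1} = C x_{t+1} + v_{t+1}`, and
`u_{t+1} = π_{t+1}(I_{t+1})`. -/
def nextStage (S : LinearSystem nx nu ny) (pi : ControlPolicy nu ny) (t : ℕ)
    (p : Hist nx nu ny t × E nx × E ny) : Stage nx nu ny :=
  let now := p.1 ⟨t, Finset.mem_Iic.2 le_rfl⟩
  let x := act S.A now.1 + act S.B now.2.2 + p.2.1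
  let y := act S.C x + p.2.2
  (x, y, pi.toFun (t + 1) (updateInfo (infoOfHist t p.1) y now.2.2))

theorem measurable_firstStage (S : LinearSystem nx nu ny) (pi : ControlPolicy nu ny) :
    Measurable (S.firstStage pi) := by
  have h0 := pi.measurable 0
  unfold firstStage
  fun_prop

theorem measurable_nextStage (S : LinearSystem nx nu ny) (pi : ControlPolicy nu ny) (t : ℕ) :
    Measurable (S.nextStage pi t) := by
  have h0 := pi.measurable (t + 1)
  have h1 : Measurable fun p : Hist nx nu ny t × E nx × E ny =>
      act S.A (p.1 ⟨t, Finset.mem_Iic.2 le_rfl⟩).1 +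
        act S.B (p.1 ⟨t, Finset.mem_Iic.2 le_rfl⟩).2.2 + p.2.1 := by fun_prop
  have h2 : Measurable fun p : Hist nx nu ny t × E nx × E ny =>
      act S.C (act S.A (p.1 ⟨t, Finset.mem_Iic.2 le_rfl⟩).1 +
        act S.B (p.1 ⟨t, Finset.mem_Iic.2 le_rfl⟩).2.2 + p.2.1) + p.2.2 := by fun_prop
  have h3 : Measurable fun p : Hist nx nu ny t × E nx × E ny => infoOfHist t p.1 :=
    (measurable_infoOfHist t).comp measurable_fst
  have h4 : Measurable fun p : Hist nx nu ny t × E nx × E ny =>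
      (p.1 ⟨t, Finset.mem_Iic.2 le_rfl⟩).2.2 := by fun_prop
  exact h1.prodMk (h2.prodMk (h0.comp
    (measurable_updateInfo.comp (h3.prodMk (h2.prodMk h4)))))

/-- The conditional law of stage `t + 1` given the history up to time `t`: `w_t` has law `γ_t(I_t)`,
and `v_{t+1}` is an independent `N(0, M)` vector. -/
def stepKernel (S : LinearSystem nx nu ny) (pi : ControlPolicy nu ny) (gam : DistPolicy nx nu ny)
    (t : ℕ) : Kernel (Hist nx nu ny t) (Stage nx nu ny) :=
  (Kernel.id ×ₖ (((gam.toKernel t).comap (infoOfHist t) (measurable_infoOfHist t)) ×ₖ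
    Kernel.const (Hist nx nu ny t) S.noise)).map (S.nextStage pi t)

instance (S : LinearSystem nx nu ny) (pi : ControlPolicy nu ny) (gam : DistPolicy nx nu ny)
    (t : ℕ) : IsMarkovKernel (S.stepKernel pi gam t) := by
  have := gam.markov t
  unfold stepKernel
  exact Kernel.IsMarkovKernel.map _ (S.measurable_nextStage pi t)

/-- The law of stage `0`, with `x_0` and `v_0` independent. -/
def firstLaw (S : LinearSystem nx nu ny) (pi : ControlPolicy nu ny) : Measure (Stage nx nu ny) :=
  (S.initLaw.prod S.noise).map (S.firstStage pi)

instance (S : LinearSystem nx nu ny) (pi : ControlPolicy nu ny) :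
    IsProbabilityMeasure (S.firstLaw pi) := by
  have := S.initLaw_prob
  exact Measure.isProbabilityMeasure_map (S.measurable_firstStage pi).aemeasurable

/-- The law of the whole closed-loop trajectory `(x_t, y_t, u_t)_{t ∈ ℕ}`. -/
def trajLaw (S : LinearSystem nx nu ny) (pi : ControlPolicy nu ny) (gam : DistPolicy nx nu ny) :
    Measure (ℕ → Stage nx nu ny) :=
  Kernel.trajMeasure (X := fun _ => Stage nx nu ny) (S.firstLaw pi) (S.stepKernel pi gam)

instance (S : LinearSystem nx nu ny) (pi : ControlPolicy nu ny) (gam : DistPolicy nx nu ny) :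
    IsProbabilityMeasure (S.trajLaw pi gam) := by
  unfold trajLaw
  infer_instance

end LinearSystem

/-! ### Costs -/

variable {nx nu ny : ℕ}

/-- The state `x_t` on the trajectory space. -/
def stateAt (t : ℕ) (ω : ℕ → Stage nx nu ny) : E nx := (ω t).1

/-- The input `u_t` on the trajectory space. -/
def inputAt (t : ℕ) (ω : ℕ → Stage nx nu ny) : E nu := (ω t).2.2

/-- The information vector `I_t` on the trajectory space. -/
def infoAt (t : ℕ) (ω : ℕ → Stage nx nu ny) : Info nu ny t :=
  (fun k => (ω k).2.1, fun k => (ω k).2.2)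

/-- `E_{x_t}[x_tᵀ Q x_t + u_tᵀ R u_t | I_t, u_t]`, computed with the regular conditional distribution
of `x_t` given `(I_t, u_t)`. -/
def condStageCost (S : LinearSystem nx nu ny) (pi : ControlPolicy nu ny)
    (gam : DistPolicy nx nu ny) (t : ℕ) (ω : ℕ → Stage nx nu ny) : ℝ≥0∞ :=
  ∫⁻ x, ENNReal.ofReal (quad S.Q x + quad S.R (inputAt t ω))
    ∂(condDistrib (stateAt t) (fun ω' => (infoAt t ω', inputAt t ω')) (S.trajLaw pi gam)
      (infoAt t ω, inputAt t ω))

/-- The expected running cost over the stages `0, …, T - 1`. -/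
def runningCost (S : LinearSystem nx nu ny) (pi : ControlPolicy nu ny) (gam : DistPolicy nx nu ny)
    (T : ℕ) : ℝ≥0∞ :=
  ∫⁻ ω, ∑ t ∈ Finset.range T, condStageCost S pi gam t ω ∂(S.trajLaw pi gam)

/-- The expected penalty `E[∑_{t<T} lam D(P_t, Qnom_t)²]` with `P_t = γ_t(I_t)`, for a discrepancy
`D` between probability measures. -/
def penalty (D : Measure (E nx) → Measure (E nx) → ℝ≥0∞) (S : LinearSystem nx nu ny) (lam : ℝ)
    (Qnom : ℕ → Measure (E nx)) (pi : ControlPolicy nu ny) (gam : DistPolicy nx nu ny)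
    (T : ℕ) : ℝ≥0∞ :=
  ∫⁻ ω, ∑ t ∈ Finset.range T,
    ENNReal.ofReal lam * D (gam.toKernel t (infoAt t ω)) (Qnom t) ^ 2 ∂(S.trajLaw pi gam)

/-- The cost of the policy pair is defined: no expected cost over a finite horizon has the
form `∞ - ∞`. -/
def CostDefined (D : Measure (E nx) → Measure (E nx) → ℝ≥0∞) (S : LinearSystem nx nu ny) (lam : ℝ)
    (Qnom : ℕ → Measure (E nx)) (pi : ControlPolicy nu ny) (gam : DistPolicy nx nu ny) : Prop :=
  ∀ T, runningCost S pi gam T ≠ ∞ ∨ penalty D S lam Qnom pi gam T ≠ ∞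

/-- The average cost
`limsup_T (1/T) E[∑_{t<T} (E[x_tᵀ Q x_t + u_tᵀ R u_t | I_t, u_t] - lam D(P_t, Qnom_t)²)]`,
an extended real number. -/
def avgCost (D : Measure (E nx) → Measure (E nx) → ℝ≥0∞) (S : LinearSystem nx nu ny) (lam : ℝ)
    (Qnom : ℕ → Measure (E nx)) (pi : ControlPolicy nu ny) (gam : DistPolicy nx nu ny) : EReal :=
  limsup (fun T : ℕ => (((T : ℝ)⁻¹ : ℝ) : EReal) *
    ((runningCost S pi gam T : EReal) - (penalty D S lam Qnom pi gam T : EReal))) atTop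

/-- `(pi, gam)` is an optimal policy pair (saddle point) of the problem
`min_π max_γ avgCost D`: its cost is defined, and no player gains by a unilateral deviation to
another admissible policy with which the cost is defined. -/
def IsOptimalPair (D : Measure (E nx) → Measure (E nx) → ℝ≥0∞) (S : LinearSystem nx nu ny) (lam : ℝ)
    (Qnom : ℕ → Measure (E nx)) (pi : ControlPolicy nu ny) (gam : DistPolicy nx nu ny) : Prop :=
  CostDefined D S lam Qnom pi gam ∧
  (∀ pi' : ControlPolicy nu ny, CostDefined D S lam Qnom pi' gam →
    avgCost D S lam Qnom pi gam ≤ avgCost D S lam Qnom pi' gam) ∧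
  (∀ gam' : DistPolicy nx nu ny, CostDefined D S lam Qnom pi gam' →
    avgCost D S lam Qnom pi gam' ≤ avgCost D S lam Qnom pi gam)

end

end WDRC

/-! The Gelbrich distance never exceeds $W_2$, and the two agree between elliptical laws with a
common generator. Replacing $\mathrm G$ by $W_2$ therefore raises the penalty of every deviation
$\gamma$, which can only lower the maximizer's payoff, and changes nothing along $\gamma^*$,
whatever control policy it is paired with. Both saddle inequalities survive (`IsOptimalPair.of_le`).

The bound $\mathrm G\le W_2$ (`gelbrich_le_wasserstein2`) is weak Kantorovich duality with quadratic
potentials. For $X\succ0$, $Y=X^{-1}$, the inequality $2\langle x,y\rangle\le x^\top Xx+y^\top Yy$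
bounds the centred cross term of any coupling by $\mathrm{Tr}(X\Sigma)+\mathrm{Tr}(Y\Sigma')$. The
infimum of this over $X$ is $2\,\mathrm{Tr}(\Sigma'^{1/2}\Sigma\Sigma'^{1/2})^{1/2}$;
`exists_dual_pair_trace_le` approaches it even for singular covariances.

For the converse (`IsElliptical.wasserstein2_le_gelbrich`), the laws of $m+LZ$ and $m'+L'Z$ are
coupled as $(m+LZ,\,m'+L'UZ)$ with $U$ orthogonal, which is allowed because $UZ$ and $Z$ have the
same law. Polar decomposition of $LL'$ gives the $U$ whose cost is exactly $\mathrm G^2$. -/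

namespace WDRC


/-! ### Trace inequalities, near-optimal dual matrices and polar decomposition. -/

section MatrixLemmas

variable {n : ℕ}

theorem trace_mul_nonneg {A B : Matrix (Fin n) (Fin n) ℝ} (hA : A.PosSemidef)
    (hB : B.PosSemidef) : 0 ≤ (A * B).trace := by
  have h : CFC.sqrt B * CFC.sqrt B = B :=
    CFC.sqrt_mul_sqrt_self B (Matrix.nonneg_iff_posSemidef.2 hB)
  have hs : (CFC.sqrt B).PosSemidef := Matrix.nonneg_iff_posSemidef.1 (CFC.sqrt_nonneg B)
  have h2 := (hA.mul_mul_conjTranspose_same (CFC.sqrt B)).trace_nonneg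
  rwa [hs.1.eq, mul_assoc, Matrix.trace_mul_comm, mul_assoc, h] at h2

theorem PosSemidef.transpose_eq {A : Matrix (Fin n) (Fin n) ℝ} (hA : A.PosSemidef) : Aᵀ = A := by
  simpa using hA.1.eq

theorem posSemidef_mul_mul_self {A B : Matrix (Fin n) (Fin n) ℝ} (hA : A.PosSemidef)
    (hB : Bᵀ = B) : (B * A * B).PosSemidef := by
  have h := hA.mul_mul_conjTranspose_same B
  rwa [Matrix.conjTranspose_eq_transpose_of_trivial, hB] at h

theorem posDef_add_smul_one {A : Matrix (Fin n) (Fin n) ℝ} (hA : A.PosSemidef) {ε : ℝ}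
    (hε : 0 < ε) : (A + ε • (1 : Matrix (Fin n) (Fin n) ℝ)).PosDef :=
  Matrix.PosDef.posSemidef_add hA (Matrix.PosDef.one.smul hε)

/-- `tr (N + δ)⁻¹ N² ≤ tr N` for positive semidefinite `N`. -/
theorem trace_inv_mul_sq_le {N : Matrix (Fin n) (Fin n) ℝ} (hN : N.PosSemidef) {δ : ℝ}
    (hδ : 0 < δ) : ((N + δ • (1 : Matrix (Fin n) (Fin n) ℝ))⁻¹ * (N * N)).trace ≤ N.trace := by
  have hH := posDef_add_smul_one hN hδ
  set H := N + δ • (1 : Matrix (Fin n) (Fin n) ℝ) with hHdef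
  have hu : IsUnit H.det := (Matrix.isUnit_iff_isUnit_det H).1 hH.isUnit
  have h1 : N * N = H * N - δ • N := by simp [hHdef, add_mul]
  have h2 : H⁻¹ * (N * N) = N - δ • (H⁻¹ * N) := by
    rw [h1, mul_sub, ← mul_assoc, Matrix.nonsing_inv_mul _ hu, one_mul, Matrix.mul_smul]
  rw [h2, Matrix.trace_sub, Matrix.trace_smul, smul_eq_mul]
  have := trace_mul_nonneg hH.inv.posSemidef hN
  nlinarith

/-- `tr (H (L + ε)⁻¹ L² (L + ε)⁻¹) ≤ tr H`. -/
theorem trace_conj_resolvent_le {H L : Matrix (Fin n) (Fin n) ℝ} (hH : H.PosSemidef)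
    (hL : L.PosSemidef) {ε : ℝ} (hε : 0 < ε) :
    ((L + ε • (1 : Matrix (Fin n) (Fin n) ℝ))⁻¹ * H *
      (L + ε • (1 : Matrix (Fin n) (Fin n) ℝ))⁻¹ * (L * L)).trace ≤ H.trace := by
  have hK := posDef_add_smul_one hL hε
  set K := L + ε • (1 : Matrix (Fin n) (Fin n) ℝ) with hKdef
  have hu : IsUnit K.det := (Matrix.isUnit_iff_isUnit_det K).1 hK.isUnit
  have h1 : K * K - L * L = (2 * ε) • L + (ε ^ 2) • (1 : Matrix (Fin n) (Fin n) ℝ) := by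
    simp only [hKdef, add_mul, mul_add, Matrix.smul_mul, Matrix.mul_smul, one_mul, mul_one]
    module
  have h2 : (K * K - L * L).PosSemidef := by
    rw [h1]
    exact (hL.smul (by positivity)).add (Matrix.PosSemidef.one.smul (by positivity))
  -- Conjugation by $K^{-1}$ turns $L^2\preceq K^2$ into $K^{-1}L^2K^{-1}\preceq1$, which is then
  -- traced against $H$.
  have h3 : (K⁻¹ * (K * K - L * L) * K⁻¹).PosSemidef :=
    posSemidef_mul_mul_self h2 (PosSemidef.transpose_eq hK.inv.posSemidef)
  have h4 : K⁻¹ * (K * K - L * L) * K⁻¹ = 1 - K⁻¹ * (L * L) * K⁻¹ := by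
    rw [mul_sub, sub_mul, ← mul_assoc K⁻¹ K K, Matrix.nonsing_inv_mul _ hu, one_mul,
      Matrix.mul_nonsing_inv _ hu]
  have h5 := trace_mul_nonneg hH h3
  rw [h4, mul_sub, mul_one, Matrix.trace_sub] at h5
  have h6 : (K⁻¹ * H * K⁻¹ * (L * L)).trace = (H * (K⁻¹ * (L * L) * K⁻¹)).trace := by
    rw [mul_assoc, mul_assoc, Matrix.trace_mul_comm]
    simp only [mul_assoc]
  linarith

/-- With $L=S'^{1/2}$ and $N=(LSL)^{1/2}$, the formal minimizer is the optimal transport matrix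
$X=LN^{-1}L$, where both traces equal $\mathrm{Tr}\,N$. As $L$ and $N$ may be singular, they are
replaced by $K=L+\varepsilon$ and $H=N+\delta$, at a total cost of at most $\eta$. -/
theorem exists_dual_pair_trace_le {S S' : Matrix (Fin n) (Fin n) ℝ} (hS : S.PosSemidef)
    (hS' : S'.PosSemidef) {η : ℝ} (hη : 0 < η) :
    ∃ X Y : Matrix (Fin n) (Fin n) ℝ, X.PosSemidef ∧ X * Y = 1 ∧
      (X * S).trace + (Y * S').trace ≤
        2 * (CFC.sqrt (CFC.sqrt S' * S * CFC.sqrt S')).trace + η := by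
  have hL : (CFC.sqrt S').PosSemidef := Matrix.nonneg_iff_posSemidef.1 (CFC.sqrt_nonneg _)
  have hLL : CFC.sqrt S' * CFC.sqrt S' = S' :=
    CFC.sqrt_mul_sqrt_self S' (Matrix.nonneg_iff_posSemidef.2 hS')
  set L := CFC.sqrt S' with hLdef
  have hLSL : (L * S * L).PosSemidef := posSemidef_mul_mul_self hS (PosSemidef.transpose_eq hL)
  have hN : (CFC.sqrt (L * S * L)).PosSemidef :=
    Matrix.nonneg_iff_posSemidef.1 (CFC.sqrt_nonneg _)
  have hNN : CFC.sqrt (L * S * L) * CFC.sqrt (L * S * L) = L * S * L :=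
    CFC.sqrt_mul_sqrt_self _ (Matrix.nonneg_iff_posSemidef.2 hLSL)
  set N := CFC.sqrt (L * S * L) with hNdef
  -- Half of the slack pays for $\mathrm{Tr}\,H=\mathrm{Tr}\,N+\delta n$.
  obtain ⟨δ, hδ, hδη⟩ : ∃ δ : ℝ, 0 < δ ∧ δ * n ≤ η / 2 := by
    refine ⟨η / (2 * (n + 1)), by positivity, ?_⟩
    rw [div_mul_eq_mul_div, div_le_div_iff₀ (by positivity) (by positivity)]
    nlinarith
  have hH := posDef_add_smul_one hN hδ
  have hb := trace_inv_mul_sq_le hN hδ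
  have htH : (N + δ • (1 : Matrix (Fin n) (Fin n) ℝ)).trace = N.trace + δ * n := by
    simp [Matrix.trace_add, Matrix.trace_smul]
  set H := N + δ • (1 : Matrix (Fin n) (Fin n) ℝ) with hHdef
  have hu : IsUnit H.det := (Matrix.isUnit_iff_isUnit_det H).1 hH.isUnit
  -- At $\varepsilon=0$ the trace is $\mathrm{Tr}(H^{-1}N^2)\le\mathrm{Tr}\,N$; continuity leaves
  -- room for a positive $\varepsilon$, which makes $K$ invertible.
  obtain ⟨ε, hεlt, hε⟩ : ∃ ε : ℝ,
      ((L + ε • (1 : Matrix (Fin n) (Fin n) ℝ)) * H⁻¹ *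
        (L + ε • (1 : Matrix (Fin n) (Fin n) ℝ)) * S).trace < N.trace + η / 2 ∧ 0 < ε := by
    have hc : Continuous fun ε : ℝ => ((L + ε • (1 : Matrix (Fin n) (Fin n) ℝ)) * H⁻¹ *
        (L + ε • (1 : Matrix (Fin n) (Fin n) ℝ)) * S).trace := by fun_prop
    have h0 : ((L + (0 : ℝ) • (1 : Matrix (Fin n) (Fin n) ℝ)) * H⁻¹ *
        (L + (0 : ℝ) • (1 : Matrix (Fin n) (Fin n) ℝ)) * S).trace < N.trace + η / 2 := by
      have : (L * H⁻¹ * L * S).trace = (H⁻¹ * (N * N)).trace := by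
        rw [hNN, mul_assoc, mul_assoc, Matrix.trace_mul_comm]
        simp only [mul_assoc]
      simp only [zero_smul, add_zero, this]
      linarith
    have hev : ∀ᶠ ε in nhdsWithin (0 : ℝ) (Set.Ioi 0),
        ((L + ε • (1 : Matrix (Fin n) (Fin n) ℝ)) * H⁻¹ *
          (L + ε • (1 : Matrix (Fin n) (Fin n) ℝ)) * S).trace < N.trace + η / 2 :=
      (hc.tendsto 0).mono_left nhdsWithin_le_nhds |>.eventually_lt_const h0
    obtain ⟨ε, h⟩ := (hev.and self_mem_nhdsWithin).exists
    exact ⟨ε, h.1, h.2⟩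
  have hK := posDef_add_smul_one hL hε
  have hc := trace_conj_resolvent_le hH.posSemidef hL hε
  set K := L + ε • (1 : Matrix (Fin n) (Fin n) ℝ) with hKdef
  have huK : IsUnit K.det := (Matrix.isUnit_iff_isUnit_det K).1 hK.isUnit
  refine ⟨K * H⁻¹ * K, K⁻¹ * H * K⁻¹, posSemidef_mul_mul_self hH.inv.posSemidef
    (PosSemidef.transpose_eq hK.posSemidef), ?_, ?_⟩
  · calc K * H⁻¹ * K * (K⁻¹ * H * K⁻¹) = K * (H⁻¹ * (K * K⁻¹) * H) * K⁻¹ := by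
          simp only [mul_assoc]
      _ = 1 := by
          rw [Matrix.mul_nonsing_inv _ huK, mul_one, Matrix.nonsing_inv_mul _ hu, mul_one,
            Matrix.mul_nonsing_inv _ huK]
  · rw [hLL, htH] at hc
    linarith

/-- Polar decomposition: a matrix `A` with `Aᵀ A = N²`, `N` symmetric, is an isometry times `N`. -/
theorem exists_polar_decomposition {A N : Matrix (Fin n) (Fin n) ℝ} (hN : Nᵀ = N)
    (h : Aᵀ * A = N * N) :
    ∃ (U : E n ≃ₗᵢ[ℝ] E n) (V : Matrix (Fin n) (Fin n) ℝ), (∀ z, U z = act V z) ∧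
      (∀ z, U.symm z = act Vᵀ z) ∧ Vᵀ * V = 1 ∧ A = V * N := by
  let a := Matrix.toEuclideanLin (𝕜 := ℝ) A
  let b := Matrix.toEuclideanLin (𝕜 := ℝ) N
  have hab : ∀ z, ‖a z‖ = ‖b z‖ := by
    intro z
    have key : ∀ B : Matrix (Fin n) (Fin n) ℝ,
        ‖Matrix.toEuclideanLin (𝕜 := ℝ) B z‖ ^ 2 = z.ofLp ⬝ᵥ ((Bᵀ * B) *ᵥ z.ofLp) := by
      intro B
      rw [EuclideanSpace.real_norm_sq_eq, Matrix.dotProduct_mulVec, ← Matrix.vecMul_vecMul,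
        ← Matrix.dotProduct_mulVec, Matrix.vecMul_transpose]
      simp [dotProduct, pow_two, Matrix.toLpLin_apply]
    have : ‖a z‖ ^ 2 = ‖b z‖ ^ 2 := by rw [key, key, h, hN]
    exact (pow_left_inj₀ (norm_nonneg _) (norm_nonneg _) two_ne_zero).1 this
  -- Since $\|Az\|=\|Nz\|$, the map $Nz\mapsto Az$ is a well-defined isometry on the range of $N$.
  -- That range may be proper, so the isometry is extended to the whole space.
  obtain ⟨s, hs⟩ := b.rangeRestrict.exists_rightInverse_of_surjective b.range_rangeRestrict
  have hs' : ∀ y : LinearMap.range b, b (s y) = y := fun y =>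
    congrArg Subtype.val (LinearMap.congr_fun hs y)
  let φ : LinearMap.range b →ₗᵢ[ℝ] E n :=
    ⟨a ∘ₗ s, fun y => by
      change ‖a (s y)‖ = ‖(y : E n)‖
      rw [hab, hs']⟩
  have hφ : ∀ z, φ.extend (b z) = a z := by
    intro z
    have h1 : φ.extend (b z) = a (s ⟨b z, LinearMap.mem_range_self b z⟩) :=
      LinearIsometry.extend_apply φ ⟨b z, LinearMap.mem_range_self b z⟩
    rw [h1, ← sub_eq_zero, ← map_sub, ← norm_eq_zero, hab, map_sub, hs', sub_self, norm_zero]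
  let U := φ.extend.toLinearIsometryEquiv rfl
  let V := (Matrix.toEuclideanLin (𝕜 := ℝ)).symm φ.extend.toLinearMap
  have hV : ∀ z, U z = act V z := by
    intro z
    have : Matrix.toEuclideanLin (𝕜 := ℝ) V = φ.extend.toLinearMap := by simp [V]
    have := LinearMap.congr_fun this z
    exact this.symm
  have hVV : Vᵀ * V = 1 := by
    ext i j
    have h1 := U.inner_map_map (EuclideanSpace.single i 1) (EuclideanSpace.single j 1)
    rw [hV, hV] at h1
    have h2 : ∀ k l, (act V (EuclideanSpace.single k (1 : ℝ))) l = V l k := by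
      intro k l; simp [act]
    rw [PiLp.inner_apply] at h1
    simp only [h2, Matrix.mul_apply, Matrix.transpose_apply, Matrix.one_apply] at h1 ⊢
    simp only [EuclideanSpace.inner_single_left, PiLp.single_apply, map_one, one_mul] at h1
    rw [← h1]
    exact Finset.sum_congr rfl fun k _ => mul_comm _ _
  refine ⟨U, V, hV, ?_, hVV, ?_⟩
  · intro z
    rw [U.symm_apply_eq, hV, act, act, Matrix.mulVec_mulVec, mul_eq_one_comm.1 hVV]
    simp
  · have : Matrix.toEuclideanLin (𝕜 := ℝ) A = Matrix.toEuclideanLin (𝕜 := ℝ) (V * N) := by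
      refine LinearMap.ext fun z => ?_
      change a z = _
      rw [← hφ z]
      change U (b z) = _
      rw [hV]
      simp [act, b, Matrix.toLpLin_apply, Matrix.mulVec_mulVec]
    exact (Matrix.toEuclideanLin (𝕜 := ℝ)).injective this

end MatrixLemmas


/-! ### Moments and the duality bound $\mathrm G\le W_2$. -/

section LowerBound

variable {n : ℕ}

theorem quad_eq_sum (L : Matrix (Fin n) (Fin n) ℝ) (z : E n) :
    quad L z = ∑ i, ∑ j, L i j * (z i * z j) := by
  simp only [quad, dotProduct, Matrix.mulVec, Finset.mul_sum]
  exact Finset.sum_congr rfl fun i _ => Finset.sum_congr rfl fun j _ => by ring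

theorem memLp_coord_sub {P : Measure (E n)} [IsProbabilityMeasure P]
    (hP : FiniteSecondMoment P) (m : E n) (i : Fin n) : MemLp (fun w : E n => w i - m i) 2 P := by
  have h : MemLp (fun w : E n => w - m) 2 P := MemLp.sub hP (memLp_const m)
  refine h.of_le (by fun_prop) (ae_of_all _ fun w => ?_)
  exact PiLp.norm_apply_le (w - m) i

theorem integrable_coord_mul {P : Measure (E n)} [IsProbabilityMeasure P]
    (hP : FiniteSecondMoment P) (m : E n) (i j : Fin n) :
    Integrable (fun w : E n => (w i - m i) * (w j - m j)) P :=
  (memLp_coord_sub hP m i).integrable_mul (memLp_coord_sub hP m j)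

theorem integrable_quad_sub {P : Measure (E n)} [IsProbabilityMeasure P]
    (hP : FiniteSecondMoment P) (L : Matrix (Fin n) (Fin n) ℝ) (m : E n) :
    Integrable (fun w => quad L (w - m)) P := by
  simp only [quad_eq_sum]
  exact integrable_finsetSum _ fun i _ => integrable_finsetSum _ fun j _ =>
    (integrable_coord_mul hP m i j).const_mul _

theorem covMat_transpose (P : Measure (E n)) : (covMat P)ᵀ = covMat P := by
  ext i j
  simp only [covMat, Matrix.transpose_apply, Matrix.of_apply]
  exact integral_congr_ae (ae_of_all _ fun w => mul_comm _ _)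

theorem integral_quad_sub_meanVec {P : Measure (E n)} [IsProbabilityMeasure P]
    (hP : FiniteSecondMoment P) (L : Matrix (Fin n) (Fin n) ℝ) :
    ∫ w, quad L (w - meanVec P) ∂P = (L * covMat P).trace := by
  simp only [quad_eq_sum]
  have hi := fun i j => (integrable_coord_mul hP (meanVec P) i j).const_mul (L i j)
  rw [← covMat_transpose P]
  simp only [PiLp.sub_apply]
  rw [integral_finsetSum _ fun i _ => integrable_finsetSum _ fun j _ => hi i j]
  simp only [Matrix.trace, Matrix.diag_apply, Matrix.mul_apply, Matrix.transpose_apply]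
  refine Finset.sum_congr rfl fun i _ => ?_
  rw [integral_finsetSum _ fun j _ => hi i j]
  refine Finset.sum_congr rfl fun j _ => ?_
  rw [integral_const_mul]
  rfl

theorem covMat_posSemidef {P : Measure (E n)} [IsProbabilityMeasure P]
    (hP : FiniteSecondMoment P) : (covMat P).PosSemidef := by
  refine Matrix.PosSemidef.of_dotProduct_mulVec_nonneg
    (by rw [Matrix.IsHermitian, Matrix.conjTranspose_eq_transpose_of_trivial, covMat_transpose])
    fun v => ?_
  have h : star v ⬝ᵥ (covMat P *ᵥ v) = (Matrix.vecMulVec v v * covMat P).trace := by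
    rw [Matrix.trace_mul_comm, Matrix.mul_vecMulVec, Matrix.trace_vecMulVec, dotProduct_comm]
    simp
  rw [h, ← integral_quad_sub_meanVec hP]
  refine integral_nonneg fun w => ?_
  have : quad (Matrix.vecMulVec v v) (w - meanVec P) = (v ⬝ᵥ (w - meanVec P).ofLp) ^ 2 := by
    simp [quad, Matrix.vecMulVec_mulVec, dotProduct_comm, pow_two]
    ring
  rw [this]
  exact sq_nonneg _

theorem isProbabilityMeasure_of_mem_couplings {P Q : Measure (E n)} [IsProbabilityMeasure P]
    {τ : Measure (E n × E n)} (h : τ ∈ couplings P Q) : IsProbabilityMeasure τ := by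
  constructor
  have h1 : τ.map Prod.fst Set.univ = 1 := by rw [h.1]; exact measure_univ
  rwa [Measure.map_apply measurable_fst MeasurableSet.univ, Set.preimage_univ] at h1

/-- Young's inequality: expand $0\le(x-Yy)^\top X(x-Yy)$ using $XY=1$. -/
theorem quad_sub_mul_add_quad_nonneg {X Y : Matrix (Fin n) (Fin n) ℝ} (hX : X.PosSemidef)
    (hXY : X * Y = 1) (x y : E n) :
    2 * inner ℝ x y ≤ quad X x + quad Y y := by
  have h := hX.dotProduct_mulVec_nonneg (x.ofLp - Y *ᵥ y.ofLp)
  have hXT : Xᵀ = X := PosSemidef.transpose_eq hX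
  have hin : inner ℝ x y = x.ofLp ⬝ᵥ y.ofLp := by
    simp [PiLp.inner_apply, dotProduct, mul_comm]
  have h1 : (Y *ᵥ y.ofLp) ⬝ᵥ (X *ᵥ x.ofLp) = x.ofLp ⬝ᵥ y.ofLp := by
    rw [Matrix.dotProduct_mulVec, ← Matrix.mulVec_transpose, hXT, Matrix.mulVec_mulVec, hXY,
      Matrix.one_mulVec, dotProduct_comm]
  have h2 : (Y *ᵥ y.ofLp) ⬝ᵥ y.ofLp = quad Y y := by rw [quad, dotProduct_comm]
  simp only [star_trivial, Matrix.mulVec_sub, Matrix.mulVec_mulVec, hXY, Matrix.one_mulVec,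
    dotProduct_sub, sub_dotProduct, h1, h2] at h
  rw [hin]
  simp only [quad] at h ⊢
  linarith

theorem quad_one_sub (X : Matrix (Fin n) (Fin n) ℝ) (x : E n) :
    quad (1 - X) x = ‖x‖ ^ 2 - quad X x := by
  rw [EuclideanSpace.real_norm_sq_eq]
  simp [quad, Matrix.sub_mulVec, mul_sub, dotProduct, pow_two]

/-- Weak duality for the quadratic transport cost, with quadratic potentials. -/
theorem quad_potentials_le_norm_sq {X Y : Matrix (Fin n) (Fin n) ℝ} (hX : X.PosSemidef)
    (hXY : X * Y = 1) (m m' x y : E n) :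
    (quad (1 - X) (x - m) + 2 * inner ℝ (m - m') (x - m) + ‖m - m'‖ ^ 2) +
      (quad (1 - Y) (y - m') - 2 * inner ℝ (m - m') (y - m')) ≤ ‖x - y‖ ^ 2 := by
  have h := quad_sub_mul_add_quad_nonneg hX hXY (x - m) (y - m')
  have e : x - y = ((x - m) - (y - m')) + (m - m') := by abel
  rw [quad_one_sub, quad_one_sub, e, norm_add_sq_real ((x - m) - (y - m')),
    norm_sub_sq_real (x - m) (y - m'), real_inner_comm (m - m'),
    inner_sub_right (m - m') (x - m)]
  linarith

theorem integral_inner_sub_meanVec {P : Measure (E n)} [IsProbabilityMeasure P]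
    (hP : FiniteSecondMoment P) (d : E n) :
    Integrable (fun w : E n => (inner ℝ d (w - meanVec P) : ℝ)) P ∧
      ∫ w, (inner ℝ d (w - meanVec P) : ℝ) ∂P = 0 := by
  have hi : Integrable (fun w : E n => w) P := MemLp.integrable one_le_two hP
  have hs : Integrable (fun w : E n => w - meanVec P) P := hi.sub (integrable_const _)
  refine ⟨hs.const_inner d, ?_⟩
  rw [integral_inner hs, integral_sub hi (integrable_const _)]
  simp [meanVec]

/-- Each potential depends on one variable only, so its integral under a coupling depends only on a
marginal. The centred linear terms vanish and the quadratic ones become traces against the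
covariances. -/
theorem integral_norm_sub_sq_ge {P Q : Measure (E n)} [IsProbabilityMeasure P]
    [IsProbabilityMeasure Q] (hP : FiniteSecondMoment P) (hQ : FiniteSecondMoment Q)
    {τ : Measure (E n × E n)} (hτ : τ ∈ couplings P Q)
    (hi : Integrable (fun z : E n × E n => ‖z.1 - z.2‖ ^ 2) τ) :
    ‖meanVec P - meanVec Q‖ ^ 2 + buresSq (covMat P) (covMat Q) ≤
      ∫ z, ‖z.1 - z.2‖ ^ 2 ∂τ := by
  refine le_of_forall_pos_le_add fun η hη => ?_
  obtain ⟨X, Y, hX, hXY, hle⟩ :=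
    exists_dual_pair_trace_le (covMat_posSemidef hP) (covMat_posSemidef hQ) hη
  set d := meanVec P - meanVec Q with hd
  let f : E n → ℝ := fun x => quad (1 - X) (x - meanVec P) + 2 * inner ℝ d (x - meanVec P) + ‖d‖ ^ 2
  let k : E n → ℝ := fun y => quad (1 - Y) (y - meanVec Q) - 2 * inner ℝ d (y - meanVec Q)
  have hP1 := integrable_quad_sub hP (1 - X) (meanVec P)
  have hP2 := (integral_inner_sub_meanVec hP d).1.const_mul 2
  have hQ1 := integrable_quad_sub hQ (1 - Y) (meanVec Q)
  have hQ2 := (integral_inner_sub_meanVec hQ d).1.const_mul 2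
  have hf : Integrable f P := (hP1.add hP2).add (integrable_const _)
  have hk : Integrable k Q := hQ1.sub hQ2
  have hfv : ∫ x, f x ∂P = ((1 - X) * covMat P).trace + ‖d‖ ^ 2 := by
    have : ∫ x, f x ∂P = _ := integral_add (hP1.add hP2) (integrable_const _)
    rw [this]
    rw [integral_add hP1 hP2, integral_quad_sub_meanVec hP, integral_const_mul,
      (integral_inner_sub_meanVec hP d).2]
    simp
  have hkv : ∫ y, k y ∂Q = ((1 - Y) * covMat Q).trace := by
    have : ∫ y, k y ∂Q = _ := integral_sub hQ1 hQ2
    rw [this, integral_quad_sub_meanVec hQ, integral_const_mul,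
      (integral_inner_sub_meanVec hQ d).2]
    simp
  rw [← hτ.1] at hf
  rw [← hτ.2] at hk
  have hf' : Integrable (fun z : E n × E n => f z.1) τ := hf.comp_measurable measurable_fst
  have hk' : Integrable (fun z : E n × E n => k z.2) τ := hk.comp_measurable measurable_snd
  have hfτ : ∫ z, f z.1 ∂τ = ∫ x, f x ∂P := by
    conv_rhs => rw [← hτ.1]
    exact (integral_map measurable_fst.aemeasurable hf.1).symm
  have hkτ : ∫ z, k z.2 ∂τ = ∫ y, k y ∂Q := by
    conv_rhs => rw [← hτ.2]
    exact (integral_map measurable_snd.aemeasurable hk.1).symm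
  have hmono : ∫ z, (f z.1 + k z.2) ∂τ ≤ ∫ z, ‖z.1 - z.2‖ ^ 2 ∂τ :=
    integral_mono (hf'.add hk') hi fun z => quad_potentials_le_norm_sq hX hXY _ _ z.1 z.2
  rw [integral_add hf' hk', hfτ, hkτ, hfv, hkv] at hmono
  have hb : buresSq (covMat P) (covMat Q) = (covMat P).trace + (covMat Q).trace -
      2 * (CFC.sqrt (CFC.sqrt (covMat Q) * covMat P * CFC.sqrt (covMat Q))).trace := by
    simp [buresSq]
  simp only [sub_mul, one_mul, Matrix.trace_sub] at hmono
  rw [hb]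
  linarith

theorem lintegral_enorm_sq_ne_top_iff {α : Type*} [MeasurableSpace α] {μ : Measure α}
    {f : α → E n} (hf : AEStronglyMeasurable f μ) :
    ∫⁻ a, ‖f a‖ₑ ^ 2 ∂μ ≠ ∞ ↔ MemLp f 2 μ := by
  rw [MemLp, eLpNorm_lt_top_iff_lintegral_rpow_enorm_lt_top two_ne_zero ENNReal.ofNat_ne_top,
    lt_top_iff_ne_top]
  simp [hf]

theorem lintegral_enorm_sq_eq_ofReal {α : Type*} [MeasurableSpace α] {μ : Measure α}
    {f : α → E n} (hf : MemLp f 2 μ) :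
    ∫⁻ a, ‖f a‖ₑ ^ 2 ∂μ = ENNReal.ofReal (∫ a, ‖f a‖ ^ 2 ∂μ) := by
  rw [ofReal_integral_eq_lintegral_ofReal hf.norm.integrable_sq
    (ae_of_all _ fun a => sq_nonneg _)]
  refine lintegral_congr fun a => ?_
  rw [ENNReal.ofReal_pow (norm_nonneg _), ofReal_norm]

/-- The Gelbrich distance is a lower bound of the Wasserstein distance. -/
theorem gelbrich_le_wasserstein2 {P Q : Measure (E n)} [IsProbabilityMeasure P]
    [IsProbabilityMeasure Q] (hQ : FiniteSecondMoment Q) : gelbrich P Q ≤ wasserstein2 P Q := by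
  refine le_iInf₂ fun τ hτ => ?_
  by_cases htop : ∫⁻ z, ‖z.1 - z.2‖ₑ ^ 2 ∂τ = ∞
  · rw [htop, ENNReal.top_rpow_of_pos (by norm_num)]
    exact le_top
  have := isProbabilityMeasure_of_mem_couplings hτ
  have hsub : MemLp (fun z : E n × E n => z.1 - z.2) 2 τ :=
    (lintegral_enorm_sq_ne_top_iff (by fun_prop)).1 htop
  have hsnd : MemLp (fun z : E n × E n => z.2) 2 τ := by
    have h : MemLp (fun w : E n => w) 2 (τ.map Prod.snd) := by rw [hτ.2]; exact hQ
    exact h.comp_of_map measurable_snd.aemeasurable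
  -- A finite transport cost passes the second moment of $Q$ on to $P$ through $x=(x-y)+y$, so the
  -- value $\infty$ of `gelbrich` does not arise here.
  have hP : FiniteSecondMoment P := by
    have h1 : MemLp (fun z : E n × E n => z.1) 2 τ := by
      refine (hsub.add hsnd).congr_norm (by fun_prop) (ae_of_all _ fun z => ?_)
      simp
    have h2 : MemLp (fun w : E n => w) 2 (τ.map Prod.fst) :=
      (memLp_map_measure_iff (by fun_prop) measurable_fst.aemeasurable).2 h1
    rw [hτ.1] at h2
    exact h2
  rw [gelbrich, if_pos ⟨hP, hQ⟩, lintegral_enorm_sq_eq_ofReal hsub,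
    ENNReal.ofReal_rpow_of_nonneg (integral_nonneg fun _ => sq_nonneg _) (by norm_num),
    ← Real.sqrt_eq_rpow]
  exact ENNReal.ofReal_le_ofReal (Real.sqrt_le_sqrt
    (integral_norm_sub_sq_ge hP hQ hτ hsub.norm.integrable_sq))

end LowerBound


/-! ### Rotation invariant laws and the coupling that attains $\mathrm G$. -/

section Elliptical

variable {n : ℕ}

/-- Invariance of a measure under the orthogonal group. -/
def RotationInvariant (μ : Measure (E n)) : Prop := ∀ U : E n ≃ₗᵢ[ℝ] E n, MeasurePreserving U μ μ

theorem sphericalMeasure_rotationInvariant {g : ℝ≥0 → ℝ≥0} (hg : Measurable g) :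
    RotationInvariant (sphericalMeasure n g) := by
  intro U
  refine ⟨U.continuous.measurable, Measure.ext fun s hs => ?_⟩
  have hm : Measurable fun z : E n => (g (‖z‖₊ ^ 2) : ℝ≥0∞) := by fun_prop
  rw [Measure.map_apply U.continuous.measurable hs, sphericalMeasure,
    withDensity_apply _ (U.continuous.measurable hs), withDensity_apply _ hs,
    ← U.measurePreserving.setLIntegral_comp_preimage hs hm]
  simp

theorem RotationInvariant.smul {μ : Measure (E n)} (h : RotationInvariant μ) (c : ℝ≥0∞) :
    RotationInvariant (c • μ) := fun U => ⟨(h U).1, by rw [Measure.map_smul, (h U).2]⟩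

theorem rotationInvariant_dirac_zero : RotationInvariant (Measure.dirac (0 : E n)) := fun U =>
  ⟨U.continuous.measurable, by rw [Measure.map_dirac' U.continuous.measurable, map_zero]⟩

theorem exists_linearIsometryEquiv_apply_eq {v w : E n} (h : ‖v‖ = ‖w‖) :
    ∃ U : E n ≃ₗᵢ[ℝ] E n, U v = w :=
  ⟨_, Submodule.reflection_sub h⟩

/-- Every $v$ is a rotation of a multiple of $a$, so one direction controls all. -/
theorem RotationInvariant.memLp_inner {μ : Measure (E n)} (hμ : RotationInvariant μ) {a : E n}
    (ha : a ≠ 0) (h : MemLp (fun z : E n => (inner ℝ a z : ℝ)) 2 μ) (v : E n) :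
    MemLp (fun z : E n => (inner ℝ v z : ℝ)) 2 μ := by
  have hnorm : ‖(‖v‖ / ‖a‖) • a‖ = ‖v‖ := by
    rw [norm_smul, norm_div, norm_norm, norm_norm, div_mul_cancel₀ _ (norm_ne_zero_iff.2 ha)]
  obtain ⟨U, hU⟩ := exists_linearIsometryEquiv_apply_eq hnorm
  have h1 := (h.const_mul (‖v‖ / ‖a‖)).comp_measurePreserving (hμ U.symm)
  refine h1.congr_norm (by fun_prop) (ae_of_all _ fun z => ?_)
  have : (inner ℝ v z : ℝ) = ‖v‖ / ‖a‖ * inner ℝ a (U.symm z) := by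
    rw [← real_inner_smul_left, ← U.inner_map_map _ (U.symm z), hU, U.apply_symm_apply]
  rw [this]
  rfl

theorem memLp_id_of_memLp_inner {μ : Measure (E n)}
    (h : ∀ v : E n, MemLp (fun z : E n => (inner ℝ v z : ℝ)) 2 μ) : FiniteSecondMoment μ := by
  refine (memLp_piLp_iff).2 fun i => ?_
  simpa [EuclideanSpace.inner_single_left] using h (EuclideanSpace.single i 1)

theorem act_apply_eq_inner (L : Matrix (Fin n) (Fin n) ℝ) (z : E n) (i : Fin n) :
    act L z i = inner ℝ (WithLp.toLp 2 (L i) : E n) z := by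
  simp [act, Matrix.mulVec, dotProduct, PiLp.inner_apply, mul_comm]

/-- If a nonzero linear image of a rotation invariant measure has finite second moment, then so
does the measure. -/
theorem RotationInvariant.finiteSecondMoment_of_act {μ : Measure (E n)}
    (hμ : RotationInvariant μ) {L : Matrix (Fin n) (Fin n) ℝ} (hL : L ≠ 0)
    (h : MemLp (act L) 2 μ) : FiniteSecondMoment μ := by
  obtain ⟨i, hi⟩ : ∃ i, L i ≠ 0 := by
    by_contra! hc
    exact hL (funext hc)
  have ha : (WithLp.toLp 2 (L i) : E n) ≠ 0 := fun h0 => hi (by simpa using h0)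
  refine memLp_id_of_memLp_inner (hμ.memLp_inner ha ?_)
  simp only [← act_apply_eq_inner]
  exact h.of_le (by fun_prop) (ae_of_all _ fun z => PiLp.norm_apply_le (act L z) i)

theorem memLp_act {μ : Measure (E n)} (hm : FiniteSecondMoment μ)
    (L : Matrix (Fin n) (Fin n) ℝ) : MemLp (act L) 2 μ :=
  (Matrix.toEuclideanLin (𝕜 := ℝ) L).toContinuousLinearMap.comp_memLp' hm

/-- Isotropy: the integral depends on $v$ only through $\|v\|$, and quadratically. The constant
$\kappa$ links dispersion to covariance, $\Sigma=\kappa LL^\top$. -/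
theorem RotationInvariant.exists_integral_inner_sq {μ : Measure (E n)}
    (hμ : RotationInvariant μ) :
    ∃ κ : ℝ, 0 ≤ κ ∧ ∀ v : E n, ∫ z, (inner ℝ v z : ℝ) ^ 2 ∂μ = κ * ‖v‖ ^ 2 := by
  by_cases hn : ∃ a : E n, a ≠ 0
  · obtain ⟨a, ha⟩ := hn
    have ha' : ‖a‖ ≠ 0 := norm_ne_zero_iff.2 ha
    refine ⟨(∫ z, (inner ℝ a z : ℝ) ^ 2 ∂μ) / ‖a‖ ^ 2,
      div_nonneg (integral_nonneg fun _ => sq_nonneg _) (sq_nonneg _), fun v => ?_⟩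
    have hnorm : ‖(‖v‖ / ‖a‖) • a‖ = ‖v‖ := by
      rw [norm_smul, norm_div, norm_norm, norm_norm, div_mul_cancel₀ _ ha']
    obtain ⟨U, hU⟩ := exists_linearIsometryEquiv_apply_eq hnorm
    have h1 := (hμ U).integral_comp U.toHomeomorph.measurableEmbedding
      fun z => (inner ℝ v z : ℝ) ^ 2
    rw [← h1, ← hU]
    simp only [U.inner_map_map, real_inner_smul_left, mul_pow]
    rw [integral_const_mul, hU]
    field_simp
  · push Not at hn
    exact ⟨0, le_rfl, fun v => by simp [hn v]⟩

/-- The isometry $z\mapsto-z$ makes the integral equal to its own negative. -/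
theorem RotationInvariant.integral_id {μ : Measure (E n)} (hμ : RotationInvariant μ) :
    ∫ z, z ∂μ = 0 := by
  have h := (hμ (LinearIsometryEquiv.neg ℝ)).integral_comp
    (LinearIsometryEquiv.neg ℝ (E := E n)).toHomeomorph.measurableEmbedding fun z => z
  simp only [LinearIsometryEquiv.coe_neg] at h
  rw [integral_neg] at h
  have h2 : (2 : ℝ) • ∫ z, z ∂μ = 0 := by
    rw [two_smul]
    nth_rewrite 1 [← h]
    exact neg_add_cancel _
  exact (smul_eq_zero.1 h2).resolve_left two_ne_zero

theorem RotationInvariant.integral_act {μ : Measure (E n)} (hμ : RotationInvariant μ)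
    (hi : Integrable (fun z : E n => z) μ) (L : Matrix (Fin n) (Fin n) ℝ) :
    ∫ z, act L z ∂μ = 0 := by
  have h := (Matrix.toEuclideanLin (𝕜 := ℝ) L).toContinuousLinearMap.integral_comp_comm hi
  rw [hμ.integral_id, map_zero] at h
  exact h

theorem integral_inner_mul_inner {μ : Measure (E n)} (hm : FiniteSecondMoment μ) {κ : ℝ}
    (hκ : ∀ v : E n, ∫ z, (inner ℝ v z : ℝ) ^ 2 ∂μ = κ * ‖v‖ ^ 2) (v w : E n) :
    ∫ z, (inner ℝ v z : ℝ) * inner ℝ w z ∂μ = κ * inner ℝ v w := by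
  have h1 := hκ (v + w)
  have hv := (hm.const_inner (𝕜 := ℝ) v).integrable_sq
  have hw := (hm.const_inner (𝕜 := ℝ) w).integrable_sq
  have hvw : Integrable (fun z : E n => (inner ℝ v z : ℝ) * inner ℝ w z) μ :=
    (hm.const_inner (𝕜 := ℝ) v).integrable_mul (hm.const_inner (𝕜 := ℝ) w)
  have e : (fun z : E n => (inner ℝ (v + w) z : ℝ) ^ 2) = fun z =>
      ((inner ℝ v z : ℝ) ^ 2 + 2 * (inner ℝ v z * inner ℝ w z)) + (inner ℝ w z : ℝ) ^ 2 := by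
    funext z
    rw [inner_add_left]
    ring
  have hs := hv.add (hvw.const_mul 2)
  simp only [Pi.add_def] at hs
  rw [e, integral_add hs hw, integral_add hv (hvw.const_mul 2),
    integral_const_mul, hκ, hκ, norm_add_sq_real] at h1
  linarith

theorem integral_norm_act_sq {μ : Measure (E n)} (hm : FiniteSecondMoment μ) {κ : ℝ}
    (hκ : ∀ v : E n, ∫ z, (inner ℝ v z : ℝ) ^ 2 ∂μ = κ * ‖v‖ ^ 2)
    (B : Matrix (Fin n) (Fin n) ℝ) :
    ∫ z, ‖act B z‖ ^ 2 ∂μ = κ * (B * Bᵀ).trace := by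
  simp only [EuclideanSpace.real_norm_sq_eq, act_apply_eq_inner]
  rw [integral_finsetSum _ fun i _ => (hm.const_inner (𝕜 := ℝ) _).integrable_sq]
  simp only [hκ, EuclideanSpace.real_norm_sq_eq, ← Finset.mul_sum]
  simp [Matrix.trace, Matrix.mul_apply, pow_two]

theorem finiteSecondMoment_map_iff {μ : Measure (E n)} [IsProbabilityMeasure μ] (m : E n)
    (L : Matrix (Fin n) (Fin n) ℝ) :
    FiniteSecondMoment (μ.map fun z => m + act L z) ↔ MemLp (act L) 2 μ := by
  have h : FiniteSecondMoment (μ.map fun z => m + act L z) ↔ MemLp (fun z => m + act L z) 2 μ :=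
    memLp_map_measure_iff (g := fun w : E n => w) (by fun_prop) (by fun_prop)
  refine h.trans ⟨fun h1 => ?_, fun h1 => (memLp_const m).add h1⟩
  refine (h1.sub (memLp_const m)).congr_norm (by fun_prop) (ae_of_all _ fun z => ?_)
  simp

/-- The mean of a location-scale image of a rotation invariant measure. -/
theorem RotationInvariant.meanVec_map {μ : Measure (E n)} [IsProbabilityMeasure μ]
    (hμ : RotationInvariant μ) (hm : FiniteSecondMoment μ) (m : E n)
    (L : Matrix (Fin n) (Fin n) ℝ) : meanVec (μ.map fun z => m + act L z) = m := by
  rw [meanVec, integral_map (by fun_prop) (by fun_prop),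
    integral_add (integrable_const _) ((memLp_act hm L).integrable one_le_two),
    hμ.integral_act (MemLp.integrable one_le_two hm)]
  simp

theorem RotationInvariant.covMat_map {μ : Measure (E n)} [IsProbabilityMeasure μ]
    (hμ : RotationInvariant μ) (hm : FiniteSecondMoment μ) {κ : ℝ}
    (hκ : ∀ v : E n, ∫ z, (inner ℝ v z : ℝ) ^ 2 ∂μ = κ * ‖v‖ ^ 2) (m : E n)
    (L : Matrix (Fin n) (Fin n) ℝ) :
    covMat (μ.map fun z => m + act L z) = κ • (L * Lᵀ) := by
  ext i j
  rw [covMat, Matrix.of_apply, hμ.meanVec_map hm, integral_map (by fun_prop) (by fun_prop)]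
  simp only [PiLp.add_apply, add_sub_cancel_left, act_apply_eq_inner]
  rw [integral_inner_mul_inner hm hκ]
  simp [Matrix.mul_apply, PiLp.inner_apply, mul_comm]

theorem posSemidef_mul_self {L : Matrix (Fin n) (Fin n) ℝ} (hL : L.PosSemidef) :
    (L * L).PosSemidef := by
  have h := posSemidef_mul_mul_self Matrix.PosSemidef.one (PosSemidef.transpose_eq hL)
  rwa [mul_one] at h

theorem buresSq_smul_sq {L L' : Matrix (Fin n) (Fin n) ℝ} (hL : L.PosSemidef)
    (hL' : L'.PosSemidef) {κ : ℝ} (hκ : 0 ≤ κ) :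
    buresSq (κ • (L * L)) (κ • (L' * L')) = κ * ((L * L).trace + (L' * L').trace -
      2 * (CFC.sqrt (L' * (L * L) * L')).trace) := by
  have h1 : CFC.sqrt (κ • (L' * L')) = √κ • L' := by
    refine CFC.sqrt_unique ?_ (Matrix.nonneg_iff_posSemidef.2 (hL'.smul (Real.sqrt_nonneg κ)))
    rw [smul_mul_smul_comm, Real.mul_self_sqrt hκ]
  have hM : (L' * (L * L) * L').PosSemidef :=
    posSemidef_mul_mul_self (posSemidef_mul_self hL) (PosSemidef.transpose_eq hL')
  have h2 : CFC.sqrt (√κ • L' * κ • (L * L) * √κ • L') = κ • CFC.sqrt (L' * (L * L) * L') := by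
    refine CFC.sqrt_unique ?_ (Matrix.nonneg_iff_posSemidef.2
      ((Matrix.nonneg_iff_posSemidef.1 (CFC.sqrt_nonneg _)).smul hκ))
    rw [smul_mul_smul_comm, CFC.sqrt_mul_sqrt_self _ (Matrix.nonneg_iff_posSemidef.2 hM)]
    simp only [smul_mul_assoc, mul_smul_comm, smul_smul]
    congr 1
    rw [mul_left_comm, Real.mul_self_sqrt hκ]
  rw [buresSq, h1, h2]
  simp only [Matrix.trace_sub, Matrix.trace_add, Matrix.trace_smul, smul_eq_mul]
  ring

/-- The orthogonal map that aligns two dispersion matrices optimally. -/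
theorem exists_optimal_rotation {L L' : Matrix (Fin n) (Fin n) ℝ} (hL : L.PosSemidef)
    (hL' : L'.PosSemidef) :
    ∃ (U : E n ≃ₗᵢ[ℝ] E n) (B : Matrix (Fin n) (Fin n) ℝ),
      (∀ z, act L z - act L' (U z) = act B z) ∧
      (B * Bᵀ).trace = (L * L).trace + (L' * L').trace -
        2 * (CFC.sqrt (L' * (L * L) * L')).trace := by
  have hLt := PosSemidef.transpose_eq hL
  have hLt' := PosSemidef.transpose_eq hL'
  have hM : (L' * (L * L) * L').PosSemidef := posSemidef_mul_mul_self (posSemidef_mul_self hL) hLt'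
  have hN : (CFC.sqrt (L' * (L * L) * L')).PosSemidef :=
    Matrix.nonneg_iff_posSemidef.1 (CFC.sqrt_nonneg _)
  have hNN := CFC.sqrt_mul_sqrt_self _ (Matrix.nonneg_iff_posSemidef.2 hM)
  set N := CFC.sqrt (L' * (L * L) * L')
  obtain ⟨U, V, -, hV, hVV, hpol⟩ := exists_polar_decomposition (A := L * L')
    (PosSemidef.transpose_eq hN) (by
      rw [hNN, Matrix.transpose_mul, hLt, hLt']
      simp only [mul_assoc])
  -- With $LL'=VN$, rotating by $V^\top$ turns the cross term $\mathrm{Tr}(L'V^\top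
  -- L)=\mathrm{Tr}(V^\top VN)$ into $\mathrm{Tr}\,N$.
  refine ⟨U.symm, L - L' * Vᵀ, fun z => ?_, ?_⟩
  · rw [hV]
    ext i
    simp only [act, PiLp.sub_apply, Matrix.mulVec_mulVec, Matrix.sub_mulVec, Pi.sub_apply]
  · have e1 : (L - L' * Vᵀ) * (L - L' * Vᵀ)ᵀ =
        L * L - L * V * L' - (L' * Vᵀ * L - L' * (Vᵀ * V) * L') := by
      simp only [Matrix.transpose_sub, Matrix.transpose_mul, Matrix.transpose_transpose, hLt,
        hLt', sub_mul, mul_sub, mul_assoc]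
      abel
    have e2 : (L' * Vᵀ * L).trace = N.trace := by
      rw [mul_assoc, Matrix.trace_mul_comm, mul_assoc, hpol, ← mul_assoc, hVV, one_mul]
    have e3 : (L * V * L').trace = N.trace := by
      rw [← Matrix.trace_transpose, ← e2]
      simp only [Matrix.transpose_mul, hLt, hLt', mul_assoc]
    rw [e1, hVV, mul_one]
    simp only [Matrix.trace_sub, e2, e3]
    ring

theorem wasserstein2_le_gelbrich_of_rotationInvariant {μ : Measure (E n)} [IsProbabilityMeasure μ]
    (hμ : RotationInvariant μ) (hm : FiniteSecondMoment μ) (m m' : E n)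
    {L L' : Matrix (Fin n) (Fin n) ℝ} (hL : L.PosSemidef) (hL' : L'.PosSemidef) :
    wasserstein2 (μ.map fun z => m + act L z) (μ.map fun z => m' + act L' z) ≤
      gelbrich (μ.map fun z => m + act L z) (μ.map fun z => m' + act L' z) := by
  obtain ⟨κ, hκ0, hκ⟩ := hμ.exists_integral_inner_sq
  have hb := buresSq_smul_sq hL hL' hκ0
  obtain ⟨U, B, hB, htr⟩ := exists_optimal_rotation hL hL'
  have hfm : ∀ (b : E n) (K : Matrix (Fin n) (Fin n) ℝ),
      FiniteSecondMoment (μ.map fun z => b + act K z) := fun b K =>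
    (finiteSecondMoment_map_iff b K).2 (memLp_act hm K)
  have hUm : Measurable U := U.continuous.measurable
  -- Both components are driven by the same $z$; the second marginal is correct because $U$
  -- preserves $\mu$.
  let τ := μ.map fun z => (m + act L z, m' + act L' (U z))
  have hτ : τ ∈ couplings (μ.map fun z => m + act L z) (μ.map fun z => m' + act L' z) := by
    constructor
    · exact Measure.map_map measurable_fst (by fun_prop)
    · rw [Measure.map_map measurable_snd (by fun_prop)]
      conv_rhs => rw [← (hμ U).map_eq]
      rw [Measure.map_map (by fun_prop) hUm]
      rfl
  have hdiff : ∀ z, m + act L z - (m' + act L' (U z)) = (m - m') + act B z := by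
    intro z
    rw [← hB]
    abel
  have hBm := memLp_act hm B
  have hBi : Integrable (act B) μ := hBm.integrable one_le_two
  have hint : ∫ z, ‖(m - m') + act B z‖ ^ 2 ∂μ = ‖m - m'‖ ^ 2 + κ * (B * Bᵀ).trace := by
    simp only [norm_add_sq_real]
    have hi := (hBi.const_inner (𝕜 := ℝ) (m - m')).const_mul 2
    have hi' := (integrable_const (μ := μ) (‖m - m'‖ ^ 2)).add hi
    simp only [Pi.add_def] at hi'
    rw [integral_add hi' hBm.norm.integrable_sq, integral_add (integrable_const _) hi, integral_const_mul, integral_inner hBi,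
      hμ.integral_act (MemLp.integrable one_le_two hm), integral_norm_act_sq hm hκ]
    simp
  refine (iInf₂_le τ hτ).trans ?_
  have hcost : ∫⁻ z, ‖z.1 - z.2‖ₑ ^ 2 ∂τ =
      ENNReal.ofReal (‖m - m'‖ ^ 2 + κ * (B * Bᵀ).trace) := by
    rw [lintegral_map (by fun_prop) (by fun_prop)]
    simp only [hdiff]
    rw [← hint]
    have hsum : MemLp (fun z => (m - m') + act B z) 2 μ := (memLp_const (m - m')).add hBm
    exact lintegral_enorm_sq_eq_ofReal hsum
  have hnn : 0 ≤ ‖m - m'‖ ^ 2 + κ * (B * Bᵀ).trace := by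
    rw [← hint]
    exact integral_nonneg fun _ => sq_nonneg _
  have hfin := And.intro (hfm m L) (hfm m' L')
  rw [gelbrich, if_pos hfin, hμ.meanVec_map hm, hμ.meanVec_map hm,
    hμ.covMat_map hm hκ, hμ.covMat_map hm hκ, PosSemidef.transpose_eq hL,
    PosSemidef.transpose_eq hL', hb, ← htr, hcost,
    ENNReal.ofReal_rpow_of_nonneg hnn (by norm_num), ← Real.sqrt_eq_rpow]

/-- For elliptical distributions with the same density generating function, the Wasserstein
distance is at most the Gelbrich distance. -/
theorem IsElliptical.wasserstein2_le_gelbrich {g : ℝ≥0 → ℝ≥0} {P Q : Measure (E n)}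
    (hP : IsElliptical g P) (hQ : IsElliptical g Q) : wasserstein2 P Q ≤ gelbrich P Q := by
  obtain ⟨hg, h0, htop, m, L, hL, rfl⟩ := hP
  obtain ⟨-, -, -, m', L', hL', rfl⟩ := hQ
  have hμ := (sphericalMeasure_rotationInvariant (n := n) hg).smul
    (sphericalMeasure n g Set.univ)⁻¹
  have hprob : IsProbabilityMeasure
      ((sphericalMeasure n g Set.univ)⁻¹ • sphericalMeasure n g) :=
    ⟨by rw [Measure.smul_apply, smul_eq_mul, ENNReal.inv_mul_cancel h0 htop]⟩
  set μ := (sphericalMeasure n g Set.univ)⁻¹ • sphericalMeasure n g with hμdef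
  by_cases hfin : FiniteSecondMoment (μ.map fun z => m + act L z) ∧
      FiniteSecondMoment (μ.map fun z => m' + act L' z)
  swap
  · rw [gelbrich, if_neg hfin]
    exact le_top
  by_cases hm : FiniteSecondMoment μ
  · exact wasserstein2_le_gelbrich_of_rotationInvariant hμ hm m m' hL hL'
  -- When $Z$ has infinite second moment but both images have a finite one, both dispersion matrices
  -- vanish. The images are then point masses, and $Z$ may be replaced by the constant $0$, which is
  -- rotation invariant with finite moments.
  have hzero : ∀ (b : E n) (K : Matrix (Fin n) (Fin n) ℝ),
      FiniteSecondMoment (μ.map fun z => b + act K z) → K = 0 := by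
    intro b K hK
    by_contra hne
    exact hm (hμ.finiteSecondMoment_of_act hne ((finiteSecondMoment_map_iff b K).1 hK))
  have hdirac : ∀ b : E n, (μ.map fun z => b + act (0 : Matrix (Fin n) (Fin n) ℝ) z) =
      (Measure.dirac (0 : E n)).map fun z => b + act (0 : Matrix (Fin n) (Fin n) ℝ) z := by
    intro b
    simp [act]
  rw [hzero m L hfin.1, hzero m' L' hfin.2, hdirac m, hdirac m']
  refine wasserstein2_le_gelbrich_of_rotationInvariant rotationInvariant_dirac_zero ?_ m m'
    Matrix.PosSemidef.zero Matrix.PosSemidef.zero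
  exact MemLp.congr_norm (f := fun _ => (0 : E n)) (memLp_const _) (by fun_prop) (by
    rw [ae_dirac_eq]
    simp)

end Elliptical

/-! ### Monotonicity of the cost in the penalty and transfer of the saddle point. -/

section Costs

variable {nx nu ny : ℕ} {D D' : Measure (E nx) → Measure (E nx) → ℝ≥0∞}
  {S : LinearSystem nx nu ny} {lam : ℝ} {Qnom : ℕ → Measure (E nx)} {pi : ControlPolicy nu ny}
  {gam : DistPolicy nx nu ny}

theorem penalty_mono (h : ∀ t I, D (gam.toKernel t I) (Qnom t) ≤ D' (gam.toKernel t I) (Qnom t))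
    (T : ℕ) : penalty D S lam Qnom pi gam T ≤ penalty D' S lam Qnom pi gam T := by
  refine lintegral_mono fun ω => Finset.sum_le_sum fun t _ => ?_
  gcongr
  exact h t _

theorem CostDefined.of_le
    (h : ∀ t I, D (gam.toKernel t I) (Qnom t) ≤ D' (gam.toKernel t I) (Qnom t))
    (hc : CostDefined D' S lam Qnom pi gam) : CostDefined D S lam Qnom pi gam := fun T =>
  (hc T).imp_right fun hT => ne_top_of_le_ne_top hT (penalty_mono h T)

theorem avgCost_anti
    (h : ∀ t I, D (gam.toKernel t I) (Qnom t) ≤ D' (gam.toKernel t I) (Qnom t)) :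
    avgCost D' S lam Qnom pi gam ≤ avgCost D S lam Qnom pi gam := by
  refine limsup_le_limsup (Eventually.of_forall fun T => ?_)
  refine mul_le_mul_of_nonneg_left (EReal.sub_le_sub le_rfl ?_)
    (EReal.coe_nonneg.2 (by positivity))
  exact EReal.coe_ennreal_le_coe_ennreal_iff.2 (penalty_mono h T)

/-- A saddle point for the penalty `D` remains one for a larger penalty `D'` that agrees with `D`
along the distribution policy of the saddle point. -/
theorem IsOptimalPair.of_le
    (hle : ∀ gam' : DistPolicy nx nu ny, ∀ t I,
      D (gam'.toKernel t I) (Qnom t) ≤ D' (gam'.toKernel t I) (Qnom t))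
    (hge : ∀ t I, D' (gam.toKernel t I) (Qnom t) ≤ D (gam.toKernel t I) (Qnom t))
    (hopt : IsOptimalPair D S lam Qnom pi gam) : IsOptimalPair D' S lam Qnom pi gam := by
  obtain ⟨hdef, hpi, hgam⟩ := hopt
  refine ⟨hdef.of_le hge, fun pi' hpi' => ?_, fun gam' hgam' => ?_⟩
  -- The penalties agree at every information vector along `gam`, so the comparison remains valid
  -- under the state law induced by any other control `pi'`.
  · exact (avgCost_anti (hle gam)).trans
      ((hpi pi' (hpi'.of_le (hle gam))).trans (avgCost_anti hge))
  · exact (avgCost_anti (hle gam')).trans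
      ((hgam gam' (hgam'.of_le (hle gam'))).trans (avgCost_anti hge))

end Costs

end WDRC

theorem mainTheorem8 {nx nu ny : ℕ} (S : WDRC.LinearSystem nx nu ny) (lam : ℝ) (hlam : 0 < lam)
    (Qnom : ℕ → Measure (WDRC.E nx)) (hprob : ∀ t, IsProbabilityMeasure (Qnom t))
    (hmom : ∀ t, WDRC.FiniteSecondMoment (Qnom t))
    (g : ℕ → ℝ≥0 → ℝ≥0) (hQ : ∀ t, WDRC.IsElliptical (g t) (Qnom t))
    (pi : WDRC.ControlPolicy nu ny) (gam : WDRC.DistPolicy nx nu ny)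
    (hopt : WDRC.IsOptimalPair WDRC.gelbrich S lam Qnom pi gam)
    (hworst : ∀ (t : ℕ) (I : WDRC.Info nu ny t), WDRC.IsElliptical (g t) (gam.toKernel t I)) :
    WDRC.IsOptimalPair WDRC.wasserstein2 S lam Qnom pi gam := by
  refine hopt.of_le (fun gam' t I => ?_) fun t I => (hworst t I).wasserstein2_le_gelbrich (hQ t)
  have := hprob t
  have := gam'.markov t
  exact WDRC.gelbrich_le_wasserstein2 (hmom t)
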